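/- Let $\mathbb F_q$ be the field with $q$ elements, and let $g(x)=g_2x^2+g_1x+g_0$ and $h(x)=h_2x^2+h_1x+h_0$ be coprime polynomials over $\mathbb F_q$ with $\max(\deg g,\deg h)=2$. If $q$ is even, assume in addition that $g_1$ and $h_1$ are not both zero. For any nonzero $f\in\mathbb F_q[x]$ which satisfies $f(g_2/h_2)\neq 0$ in case $h_2\neq 0$ (call such $f$ admissible), set $f_R(x)=h(x)^{\deg f}\cdot f\bigl(g(x)/h(x)\bigr)$. Let $n\ge 1$ be an integer, and put $$H(x)=ax^{q^n+1}-b(x^{q^n}+x)+c,$$ where $a=g_2h_1-g_1h_2$, $b=g_0h_2-g_2h_0$, $c=g_1h_0-g_0h_1$. (1) Every irreducible polynomial of the form $f_R(x)$ for some admissible $f$, and of degree $2n/d$ with $d$ odd, divides $H(x)$. (2) Let $F\in\mathbb F_q[x]$ be an irreducible factor of $H(x)$ of degree higher than one which is not a scalar multiple of $ax^2-2bx+c$. Then $\deg F$ divides $2n$ but not $n$. Moreover, unless $F$ is a scalar multiple of $h(x)$, there are an admissible $f\in\mathbb F_q[x]$ and a nonzero scalar $u\in\mathbb F_q$ such that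 $F=u\,f_R$. -/

import Mathlib

open Polynomial

noncomputable section

/-- The polynomial `f_R(x) = h(x)^(deg f) * f(g(x)/h(x))` obtained from `f` through the
rational expression `R = g/h`, with denominators cleared. -/
def quadTransform {K : Type*} [Field K] (g h f : K[X]) : K[X] :=
  ∑ i ∈ Finset.range (f.natDegree + 1), C (f.coeff i) * g ^ i * h ^ (f.natDegree - i)

/-- In the field of rational functions, `f_R` is literally `h^(deg f) * f(g/h)`. -/
theorem algebraMap_quadTransform {K : Type*} [Field K] (g h f : K[X]) (hh : h ≠ 0) :
    algebraMap K[X] (RatFunc K) (quadTransform g h f) =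
      algebraMap K[X] (RatFunc K) h ^ f.natDegree *
        aeval (algebraMap K[X] (RatFunc K) g / algebraMap K[X] (RatFunc K) h) f := by
  have hh' : algebraMap K[X] (RatFunc K) h ≠ 0 := by
    simpa using hh
  rw [quadTransform, aeval_eq_sum_range, Finset.mul_sum, map_sum]
  refine Finset.sum_congr rfl fun i hi => ?_
  have hi' : i ≤ f.natDegree := Nat.lt_succ_iff.mp (Finset.mem_range.mp hi)
  have hp : algebraMap K[X] (RatFunc K) h ^ f.natDegree =
      algebraMap K[X] (RatFunc K) h ^ (f.natDegree - i) * algebraMap K[X] (RatFunc K) h ^ i := by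
    rw [← pow_add, Nat.sub_add_cancel hi']
  rw [hp, Algebra.smul_def, IsScalarTower.algebraMap_apply K K[X] (RatFunc K)]
  simp only [map_mul, map_pow, div_pow, Polynomial.algebraMap_eq]
  field_simp

/-- The polynomials `f` to which the transformation by `R = g/h` is applied: `f` is nonzero, and
`g₂/h₂` (the value of `R` at infinity) is not a root of `f` in case `h₂ ≠ 0`. -/
def QuadAdmissible {K : Type*} [Field K] (g h f : K[X]) : Prop :=
  f ≠ 0 ∧ (h.coeff 2 ≠ 0 → f.eval (g.coeff 2 / h.coeff 2) ≠ 0)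

/-- The polynomial `a x^(N+1) - b (x^N + x) + c`. -/
def quadH {K : Type*} [Field K] (a b c : K) (N : ℕ) : K[X] :=
  C a * X ^ (N + 1) - C b * (X ^ N + X) + C c

end

/-! Let `x` be a root of an irreducible polynomial, `y = x^(q^n)` and `R = g/h`. Since `g(x)h(y) -
g(y)h(x) = (x - y)(axy - b(x + y) + c)` (`aeval_cross_eq`), `H(x) = 0` says that `y` is the second
point of the fibre of `R` through `x`. When `h(x) ≠ 0`, the value `β = R(x)` is thus fixed by the
`q^n`-Frobenius exactly when `y = x` or `H(x) = 0`.

For (1), `β` has degree `deg f = n/d`, so it is fixed, while `x` of degree `2n/d` with `d` odd is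
not; hence `H(x) = 0`. For (2), swapping the points of a fibre is an involution, nondegenerate
because `b² ≠ ac`, so `x^(q^(2n)) = x`; and `y = x` would make `x` a root of `ax² - 2bx + c`.
Finally `deg β` divides `n` and `deg F`, but `deg F` does not divide `n`, so `deg F ≥ 2 deg β`, and
`F` is proportional to `f_R` for `f` the minimal polynomial of `β`. -/

section QuadraticTransformation

variable {K : Type*} [Field K]

/-! ### Values and degree of `f_R` -/

theorem aeval_eq_quadratic {L : Type*} [CommRing L] [Algebra K L] {p : K[X]}
    (hp : p.natDegree ≤ 2) (x : L) :
    aeval x p = algebraMap K L (p.coeff 2) * x ^ 2 + algebraMap K L (p.coeff 1) * x +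
      algebraMap K L (p.coeff 0) := by
  rw [aeval_eq_sum_range' (n := 3) (by omega)]
  simp [Finset.sum_range_succ, Algebra.smul_def]
  ring

theorem aeval_quadTransform {L : Type*} [Field L] [Algebra K L] (g h f : K[X]) {x : L}
    (hx : aeval x h ≠ 0) :
    aeval x (quadTransform g h f) =
      aeval x h ^ f.natDegree * aeval (aeval x g / aeval x h) f := by
  rw [quadTransform, map_sum, aeval_eq_sum_range (p := f), Finset.mul_sum]
  refine Finset.sum_congr rfl fun i hi => ?_
  have hi' : i ≤ f.natDegree := Nat.lt_succ_iff.mp (Finset.mem_range.mp hi)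
  rw [← Nat.sub_add_cancel hi', pow_add]
  simp only [Nat.sub_add_cancel hi', map_mul, map_pow, aeval_C, Algebra.smul_def, div_pow]
  field_simp

theorem aeval_quadTransform_of_root {L : Type*} [Field L] [Algebra K L] (g h f : K[X]) {x : L}
    (hx : aeval x h = 0) :
    aeval x (quadTransform g h f) =
      algebraMap K L f.leadingCoeff * aeval x g ^ f.natDegree := by
  rw [quadTransform, map_sum, Finset.sum_range_succ, Finset.sum_eq_zero]
  · simp
  · intro i hi
    have : f.natDegree - i ≠ 0 := by
      have := Finset.mem_range.mp hi
      omega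
    simp [hx, this]

theorem aeval_denom_ne_zero_of_quadTransform_root {L : Type*} [Field L] [Algebra K L]
    {g h f : K[X]} (hcop : IsCoprime g h) (hf : f ≠ 0) {x : L}
    (hx : aeval x (quadTransform g h f) = 0) : aeval x h ≠ 0 := by
  intro hh
  rw [aeval_quadTransform_of_root g h f hh, mul_eq_zero] at hx
  rcases hx with hx | hx
  · simp [hf] at hx
  · obtain ⟨u, v, huv⟩ := hcop
    have := congrArg (aeval x) huv
    simp [hh, eq_zero_of_pow_eq_zero hx] at this

/-- The coefficient of `f_R` at `2 deg f` is `h₂^(deg f) f(g₂/h₂)`, or `lc(f) g₂^(deg f)` if `h₂ =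
0`; admissibility is what keeps it nonzero. -/
theorem natDegree_quadTransform {g h f : K[X]} (hdeg : max g.natDegree h.natDegree = 2)
    (hf : QuadAdmissible g h f) : (quadTransform g h f).natDegree = 2 * f.natDegree := by
  have hg2 : g.natDegree ≤ 2 := hdeg ▸ le_max_left _ _
  have hh2 : h.natDegree ≤ 2 := hdeg ▸ le_max_right _ _
  refine le_antisymm ?_ ?_
  · refine natDegree_sum_le_of_forall_le _ _ fun i hi => ?_
    have hi' : i ≤ f.natDegree := Nat.lt_succ_iff.mp (Finset.mem_range.mp hi)
    calc (C (f.coeff i) * g ^ i * h ^ (f.natDegree - i)).natDegree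
        ≤ (C (f.coeff i) * g ^ i).natDegree + (h ^ (f.natDegree - i)).natDegree :=
          natDegree_mul_le
      _ ≤ i * 2 + (f.natDegree - i) * 2 := by
          refine add_le_add ((natDegree_C_mul_le _ _).trans (natDegree_pow_le_of_le i hg2))
            (natDegree_pow_le_of_le _ hh2)
      _ = 2 * f.natDegree := by omega
  · have hcoeff : (quadTransform g h f).coeff (2 * f.natDegree) =
        ∑ i ∈ Finset.range (f.natDegree + 1),
          f.coeff i * g.coeff 2 ^ i * h.coeff 2 ^ (f.natDegree - i) := by
      rw [quadTransform, finsetSum_coeff]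
      refine Finset.sum_congr rfl fun i hi => ?_
      have hi' : i ≤ f.natDegree := Nat.lt_succ_iff.mp (Finset.mem_range.mp hi)
      have e : 2 * f.natDegree = i * 2 + (f.natDegree - i) * 2 := by omega
      rw [mul_assoc, coeff_C_mul, e, coeff_mul_add_eq_of_natDegree_le
        (natDegree_pow_le_of_le i hg2) (natDegree_pow_le_of_le _ hh2),
        coeff_pow_of_natDegree_le hg2, coeff_pow_of_natDegree_le hh2, mul_assoc]
    refine le_natDegree_of_ne_zero ?_
    rw [hcoeff]
    by_cases h0 : h.coeff 2 = 0
    · have hg0 : g.coeff 2 ≠ 0 := by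
        intro hg0
        have key : ∀ p : K[X], p.natDegree ≤ 2 → p.coeff 2 = 0 → p.natDegree < 2 := by
          intro p hp hp2
          refine lt_of_le_of_ne hp fun e => ?_
          rw [← e, coeff_natDegree, leadingCoeff_eq_zero] at hp2
          simp [hp2] at e
        have := max_lt (key g hg2 hg0) (key h hh2 h0)
        omega
      rw [Finset.sum_range_succ, Finset.sum_eq_zero]
      · simp [hf.1, hg0]
      · intro i hi
        have : f.natDegree - i ≠ 0 := by
          have := Finset.mem_range.mp hi
          omega
        simp [h0, this]
    · have he := hf.2 h0
      intro hs
      apply he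
      rw [eval_eq_sum_range]
      have : h.coeff 2 ^ f.natDegree * ∑ i ∈ Finset.range (f.natDegree + 1),
          f.coeff i * (g.coeff 2 / h.coeff 2) ^ i = 0 := by
        rw [← hs, Finset.mul_sum]
        refine Finset.sum_congr rfl fun i hi => ?_
        have hi' : i ≤ f.natDegree := Nat.lt_succ_iff.mp (Finset.mem_range.mp hi)
        rw [← Nat.sub_add_cancel hi', pow_add]
        simp only [Nat.sub_add_cancel hi', div_pow]
        field_simp
      exact (mul_eq_zero.mp this).resolve_left (pow_ne_zero _ h0)

/-! ### Nondegeneracy of `a, b, c` and the fibre identity -/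

/-- Coprime polynomials that are not both constant are not proportional. -/
theorem not_proportional_of_isCoprime {g h : K[X]} (hcop : IsCoprime g h)
    (hdeg : 0 < max g.natDegree h.natDegree) {s t : K} (hst : C s * g = C t * h) :
    s = 0 ∧ t = 0 := by
  wlog hs : s ≠ 0 generalizing g h s t
  · push Not at hs
    refine ⟨hs, ?_⟩
    by_contra ht
    exact ht (this hcop.symm (max_comm g.natDegree _ ▸ hdeg) hst.symm ht).1
  exfalso
  have hd : h ∣ g := by
    refine ⟨C (t / s), ?_⟩
    have : C s * g = C s * (h * C (t / s)) := by
      rw [hst, mul_left_comm, ← C_mul, mul_div_cancel₀ _ hs, mul_comm]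
    exact mul_left_cancel₀ (C_ne_zero.mpr hs) this
  have hu : IsUnit h := hcop.isUnit_of_dvd' hd dvd_rfl
  have hh0 := natDegree_eq_zero_of_isUnit hu
  have hg0 : g.natDegree = 0 := by
    have h1 : (C s * g).natDegree = g.natDegree := natDegree_C_mul hs
    have h2 : (C t * h).natDegree ≤ h.natDegree := natDegree_C_mul_le t h
    rw [hst] at h1
    omega
  simp [hh0, hg0] at hdeg

theorem C_mul_eq_C_mul_of_coeff {g h : K[X]} (hg : g.natDegree ≤ 2) (hh : h.natDegree ≤ 2)
    {s t : K} (h0 : s * g.coeff 0 = t * h.coeff 0) (h1 : s * g.coeff 1 = t * h.coeff 1)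
    (h2 : s * g.coeff 2 = t * h.coeff 2) : C s * g = C t * h := by
  ext i
  rw [coeff_C_mul, coeff_C_mul]
  match i with
  | 0 => exact h0
  | 1 => exact h1
  | 2 => exact h2
  | i + 3 =>
    rw [coeff_eq_zero_of_natDegree_lt (show g.natDegree < i + 3 by omega),
      coeff_eq_zero_of_natDegree_lt (show h.natDegree < i + 3 by omega), mul_zero, mul_zero]

/-- The resultant of two coprime polynomials of maximal degree two does not vanish. -/
theorem sq_sub_mul_ne_zero_of_isCoprime {g h : K[X]} (hcop : IsCoprime g h)
    (hdeg : max g.natDegree h.natDegree = 2) {a b c : K}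
    (ha : a = g.coeff 2 * h.coeff 1 - g.coeff 1 * h.coeff 2)
    (hb : b = g.coeff 0 * h.coeff 2 - g.coeff 2 * h.coeff 0)
    (hc : c = g.coeff 1 * h.coeff 0 - g.coeff 0 * h.coeff 1) : b ^ 2 ≠ a * c := by
  intro hbac
  have hg2 : g.natDegree ≤ 2 := hdeg ▸ le_max_left _ _
  have hh2 : h.natDegree ≤ 2 := hdeg ▸ le_max_right _ _
  have hpos : 0 < max g.natDegree h.natDegree := by omega
  have hprop {s t : K} (h0 : s * g.coeff 0 = t * h.coeff 0) (h1 : s * g.coeff 1 = t * h.coeff 1)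
      (h2 : s * g.coeff 2 = t * h.coeff 2) : s = 0 ∧ t = 0 :=
    not_proportional_of_isCoprime hcop hpos (C_mul_eq_C_mul_of_coeff hg2 hh2 h0 h1 h2)
  by_cases ha0 : a = 0
  · have hb0 : b = 0 := by simpa [ha0] using hbac
    have := hprop (s := h.coeff 2) (t := g.coeff 2) (by linear_combination hb0 - hb)
      (by linear_combination ha - ha0) (by ring)
    have hkey : ∀ p : K[X], p.natDegree = 2 → p.coeff 2 ≠ 0 := by
      intro p hp hp2
      rw [← hp, coeff_natDegree, leadingCoeff_eq_zero] at hp2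
      simp [hp2] at hp
    rcases max_choice g.natDegree h.natDegree with hm | hm
    · exact hkey g (hm ▸ hdeg) this.2
    · exact hkey h (hm ▸ hdeg) this.1
  -- If `b² = ac`, then `b/a` is the double root of `ax² - 2bx + c`. There `h(x) g = g(x) h`, so `g`
  -- and `h` both vanish at it, against coprimality.
  · obtain ⟨x, hx⟩ : ∃ x, a * x = b := ⟨b / a, mul_div_cancel₀ b ha0⟩
    have hcx : b * x = c := by
      refine mul_left_cancel₀ ha0 ?_
      linear_combination hbac + b * hx
    have hcx2 : a * x ^ 2 = c := by linear_combination hcx + x * hx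
    have eg := aeval_eq_quadratic hg2 x
    have eh := aeval_eq_quadratic hh2 x
    simp only [Algebra.algebraMap_self, RingHom.id_apply] at eg eh
    have hz := hprop (s := aeval x h) (t := aeval x g)
      (by rw [eg, eh]; linear_combination x * hcx - x ^ 2 * hb + x * hc)
      (by rw [eg, eh]; linear_combination -hcx2 + x ^ 2 * ha - hc)
      (by rw [eg, eh]; linear_combination hx - x * ha + hb)
    obtain ⟨u, v, huv⟩ := hcop
    have := congrArg (aeval x) huv
    simp [-coe_aeval_eq_eval, hz.1, hz.2] at this

theorem aeval_cross_eq {L : Type*} [Field L] [Algebra K L] {g h : K[X]}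
    (hg : g.natDegree ≤ 2) (hh : h.natDegree ≤ 2) {a b c : K}
    (ha : a = g.coeff 2 * h.coeff 1 - g.coeff 1 * h.coeff 2)
    (hb : b = g.coeff 0 * h.coeff 2 - g.coeff 2 * h.coeff 0)
    (hc : c = g.coeff 1 * h.coeff 0 - g.coeff 0 * h.coeff 1) (x y : L) :
    aeval x g * aeval y h - aeval y g * aeval x h =
      (x - y) * (algebraMap K L a * (x * y) - algebraMap K L b * (x + y) + algebraMap K L c) := by
  simp only [aeval_eq_quadratic hg, aeval_eq_quadratic hh, ha, hb, hc, map_sub, map_mul]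
  ring

theorem aeval_quadH {L : Type*} [Field L] [Algebra K L] (a b c : K) (N : ℕ) (x : L) :
    aeval x (quadH a b c N) =
      algebraMap K L a * (x * x ^ N) - algebraMap K L b * (x + x ^ N) + algebraMap K L c := by
  simp [quadH]
  ring

theorem exists_eq_C_mul_of_dvd {F p : K[X]} (hF : F ∣ p) (hp : p ≠ 0)
    (hdeg : p.natDegree ≤ F.natDegree) : ∃ u : K, u ≠ 0 ∧ F = C u * p := by
  obtain ⟨v, hv⟩ := (associated_of_dvd_of_natDegree_le hF hp hdeg).symm
  obtain ⟨u, hu, huv⟩ := Polynomial.isUnit_iff.mp v.isUnit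
  exact ⟨u, hu.ne_zero, by rw [← hv, ← huv, mul_comm]⟩

theorem aeval_eq_zero_iff_dvd {L : Type*} [Field L] [Algebra K L] {F : K[X]}
    (hF : Irreducible F) {x : L} (hx : aeval x F = 0) {p : K[X]} :
    aeval x p = 0 ↔ F ∣ p := by
  refine ⟨fun hp => ?_, fun hp => aeval_eq_zero_of_dvd_aeval_eq_zero hp hx⟩
  exact ((hF.dvd_iff.mp (minpoly.dvd K x hx)).resolve_left (minpoly.not_isUnit K x)).dvd.trans (minpoly.dvd K x hp)

/-! ### Frobenius and the two halves of the theorem -/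

variable [Fintype K]

theorem pow_card_pow_eq_self_iff {L : Type*} [Field L] [Algebra K L] {F : K[X]}
    (hF : Irreducible F) {x : L} (hx : aeval x F = 0) (n : ℕ) :
    x ^ Fintype.card K ^ n = x ↔ F.natDegree ∣ n := by
  rw [hF.natDegree_dvd_iff_dvd_X_pow_card_pow_sub_X, ← aeval_eq_zero_iff_dvd hF hx,
    Nat.card_eq_fintype_card]
  simp [sub_eq_zero]

theorem aeval_pow_card_pow {L : Type*} [Field L] [Algebra K L] (p : K[X]) (x : L) (n : ℕ) :
    aeval (x ^ Fintype.card K ^ n) p = aeval x p ^ Fintype.card K ^ n := by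
  have e (y : L) : (FiniteField.frobeniusAlgHom K L ^ n) y = y ^ Fintype.card K ^ n := by
    rw [AlgHom.coe_pow, FiniteField.coe_frobeniusAlgHom, pow_iterate]
  rw [← e, ← e, aeval_algHom_apply]

theorem quadTransform_dvd_quadH {g h f : K[X]} (hcop : IsCoprime g h)
    (hdeg : max g.natDegree h.natDegree = 2) {a b c : K}
    (ha : a = g.coeff 2 * h.coeff 1 - g.coeff 1 * h.coeff 2)
    (hb : b = g.coeff 0 * h.coeff 2 - g.coeff 2 * h.coeff 0)
    (hc : c = g.coeff 1 * h.coeff 0 - g.coeff 0 * h.coeff 1)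
    {n d : ℕ} (hf : QuadAdmissible g h f)
    (hirr : Irreducible (quadTransform g h f)) (hd : Odd d)
    (hdn : d * (quadTransform g h f).natDegree = 2 * n) :
    quadTransform g h f ∣ quadH a b c (Fintype.card K ^ n) := by
  have hg2 : g.natDegree ≤ 2 := hdeg ▸ le_max_left _ _
  have hh2 : h.natDegree ≤ 2 := hdeg ▸ le_max_right _ _
  have : Fact (Irreducible (quadTransform g h f)) := ⟨hirr⟩
  let L := AdjoinRoot (quadTransform g h f)
  let x : L := AdjoinRoot.root _
  have hx : aeval x (quadTransform g h f) = 0 := by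
    simp [x, L, AdjoinRoot.aeval_eq]
  have hhx := aeval_denom_ne_zero_of_quadTransform_root hcop hf.1 hx
  set β := aeval x g / aeval x h with hβ
  have hfβ : aeval β f = 0 := by
    rw [aeval_quadTransform g h f hhx, mul_eq_zero] at hx
    exact hx.resolve_left (pow_ne_zero _ hhx)
  have hβint : IsIntegral K β := (isAlgebraic_iff_isIntegral.mp ⟨f, hf.1, hfβ⟩)
  have hpf : minpoly K β ∣ f := minpoly.dvd K β hfβ
  have hp : QuadAdmissible g h (minpoly K β) :=
    ⟨minpoly.ne_zero hβint, fun h0 he => hf.2 h0 (eval_eq_zero_of_dvd_of_eval_eq_zero hpf he)⟩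
  have hpx : aeval x (quadTransform g h (minpoly K β)) = 0 := by
    rw [aeval_quadTransform g h _ hhx, ← hβ, minpoly.aeval, mul_zero]
  have hpdeg := natDegree_quadTransform hdeg hp
  have hfdeg := natDegree_quadTransform hdeg hf
  have hppos : 0 < (minpoly K β).natDegree := minpoly.natDegree_pos hβint
  have hdvd : quadTransform g h f ∣ quadTransform g h (minpoly K β) :=
    (aeval_eq_zero_iff_dvd hirr hx).mp hpx
  -- Comparing degrees gives `deg f ≤ deg β`, so `β` has degree exactly `deg f`, without first
  -- showing `f` irreducible.
  have hle := natDegree_le_of_dvd hdvd (ne_zero_of_natDegree_gt (n := 0) (by omega))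
  have hle' := natDegree_le_of_dvd hpf hf.1
  have hk : (minpoly K β).natDegree = f.natDegree := by omega
  rw [hfdeg] at hdn
  have hdn' : n = d * f.natDegree := by linarith
  have hβn : β ^ Fintype.card K ^ n = β := by
    rw [pow_card_pow_eq_self_iff (minpoly.irreducible hβint) (minpoly.aeval K β), hk, hdn']
    exact dvd_mul_left _ _
  have hxn : x ^ Fintype.card K ^ n ≠ x := by
    rw [Ne, pow_card_pow_eq_self_iff hirr hx, hfdeg, hdn']
    intro h2
    have := Nat.dvd_of_mul_dvd_mul_right (by omega) h2
    exact Nat.not_even_iff_odd.mpr hd (even_iff_two_dvd.mpr this)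
  have hcross := aeval_cross_eq hg2 hh2 ha hb hc x (x ^ Fintype.card K ^ n)
  have hzero : aeval x g * aeval (x ^ Fintype.card K ^ n) h -
      aeval (x ^ Fintype.card K ^ n) g * aeval x h = 0 := by
    rw [aeval_pow_card_pow, aeval_pow_card_pow]
    rw [hβ, div_pow, div_eq_div_iff (pow_ne_zero _ hhx) hhx] at hβn
    rw [hβn, sub_self]
  rw [hzero, ← aeval_quadH] at hcross
  have hH := (mul_eq_zero.mp hcross.symm).resolve_left (sub_ne_zero.mpr hxn.symm)
  exact (aeval_eq_zero_iff_dvd hirr hx).mp hH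

/-- If all coefficients vanish, `b² ≠ ac` leaves `b ≠ 0`, so the characteristic is 2. The relation
`g₀a + g₁b + g₂c = 0` and its analogue for `h` then give `g₁ = h₁ = 0`, the excluded case. -/
theorem diagonal_ne_zero {g h : K[X]} (hcop : IsCoprime g h)
    (hdeg : max g.natDegree h.natDegree = 2)
    (heven : Even (Fintype.card K) → ¬ (g.coeff 1 = 0 ∧ h.coeff 1 = 0)) {a b c : K}
    (ha : a = g.coeff 2 * h.coeff 1 - g.coeff 1 * h.coeff 2)
    (hb : b = g.coeff 0 * h.coeff 2 - g.coeff 2 * h.coeff 0)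
    (hc : c = g.coeff 1 * h.coeff 0 - g.coeff 0 * h.coeff 1) :
    C a * X ^ 2 - C (2 * b) * X + C c ≠ 0 := by
  intro hQ
  have hres := sq_sub_mul_ne_zero_of_isCoprime hcop hdeg ha hb hc
  have h2 := congrArg (coeff · 2) hQ
  have h1 := congrArg (coeff · 1) hQ
  have h0 := congrArg (coeff · 0) hQ
  simp only [coeff_add, coeff_sub, coeff_C_mul, coeff_X_pow, coeff_X, coeff_C, coeff_zero] at h0 h1 h2
  norm_num at h0 h1 h2
  have hb0 : b ≠ 0 := by
    rintro rfl
    exact hres (by simp [h2])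
  have hchar : (2 : K) = 0 := h1.resolve_right hb0
  have hcard : Even (Fintype.card K) := by
    rw [Nat.even_iff, ← FiniteField.even_card_iff_char_two]
    exact CharP.ringChar_of_prime_eq_zero Nat.prime_two (by exact_mod_cast hchar)
  refine heven hcard ⟨?_, ?_⟩
  · refine (mul_eq_zero.mp (?_ : b * g.coeff 1 = 0)).resolve_left hb0
    linear_combination g.coeff 1 * hb - g.coeff 0 * (ha.symm.trans h2) -
      g.coeff 2 * (hc.symm.trans h0)
  · refine (mul_eq_zero.mp (?_ : b * h.coeff 1 = 0)).resolve_left hb0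
    linear_combination h.coeff 1 * hb - h.coeff 0 * (ha.symm.trans h2) -
      h.coeff 2 * (hc.symm.trans h0)

theorem pow_card_pow_two_mul_eq_self {L : Type*} [Field L] [Algebra K L] {a b c : K}
    (hres : b ^ 2 ≠ a * c) {n : ℕ} {x : L}
    (hx : aeval x (quadH a b c (Fintype.card K ^ n)) = 0) :
    x ^ Fintype.card K ^ (2 * n) = x := by
  have hy : aeval (x ^ Fintype.card K ^ n) (quadH a b c (Fintype.card K ^ n)) = 0 := by
    rw [aeval_pow_card_pow, hx, zero_pow (pow_ne_zero _ Fintype.card_ne_zero)]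
  rw [two_mul, pow_add, pow_mul]
  rw [aeval_quadH] at hx hy
  set y := x ^ Fintype.card K ^ n
  set z := y ^ Fintype.card K ^ n
  -- `H` vanishes at both `x` and `y`; subtracting the two equations factors. The second factor is
  -- nonzero because `H(x) = 0` gives `(ax - b)(ay - b) = b² - ac`.
  have hprod : (z - x) * (algebraMap K L a * y - algebraMap K L b) = 0 := by
    linear_combination hy - hx
  refine sub_eq_zero.mp ((mul_eq_zero.mp hprod).resolve_right fun h0 => hres ?_)
  apply (algebraMap K L).injective
  rw [map_pow, map_mul]
  linear_combination (algebraMap K L a * x - algebraMap K L b) * h0 - algebraMap K L a * hx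

theorem natDegree_of_dvd_quadH {g h F : K[X]} (hcop : IsCoprime g h)
    (hdeg : max g.natDegree h.natDegree = 2)
    (heven : Even (Fintype.card K) → ¬ (g.coeff 1 = 0 ∧ h.coeff 1 = 0)) {a b c : K}
    (ha : a = g.coeff 2 * h.coeff 1 - g.coeff 1 * h.coeff 2)
    (hb : b = g.coeff 0 * h.coeff 2 - g.coeff 2 * h.coeff 0)
    (hc : c = g.coeff 1 * h.coeff 0 - g.coeff 0 * h.coeff 1)
    {n : ℕ} (hF : Irreducible F) (hFH : F ∣ quadH a b c (Fintype.card K ^ n))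
    (hF1 : 1 < F.natDegree)
    (hFQ : ¬ ∃ u : K, F = C u * (C a * X ^ 2 - C (2 * b) * X + C c)) :
    F.natDegree ∣ 2 * n ∧ ¬ F.natDegree ∣ n := by
  have : Fact (Irreducible F) := ⟨hF⟩
  let L := AdjoinRoot F
  let x : L := AdjoinRoot.root F
  have hx : aeval x F = 0 := by simp [x, L, AdjoinRoot.aeval_eq]
  have hxH := aeval_eq_zero_of_dvd_aeval_eq_zero hFH hx
  rw [← pow_card_pow_eq_self_iff hF hx, ← pow_card_pow_eq_self_iff hF hx]
  refine ⟨pow_card_pow_two_mul_eq_self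
    (sq_sub_mul_ne_zero_of_isCoprime hcop hdeg ha hb hc) hxH, fun hn => hFQ ?_⟩
  rw [aeval_quadH, hn] at hxH
  have hxQ : aeval x (C a * X ^ 2 - C (2 * b) * X + C c) = 0 := by
    simp only [map_add, map_sub, map_mul, map_pow, aeval_C, aeval_X, map_ofNat]
    linear_combination hxH
  obtain ⟨u, -, hu⟩ := exists_eq_C_mul_of_dvd
    ((aeval_eq_zero_iff_dvd hF hx).mp hxQ)
    (diagonal_ne_zero hcop hdeg heven ha hb hc) (le_trans (by compute_degree) hF1)
  exact ⟨u, hu⟩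

theorem exists_quadTransform_of_dvd_quadH {g h F : K[X]} (hcop : IsCoprime g h)
    (hdeg : max g.natDegree h.natDegree = 2) {a b c : K}
    (ha : a = g.coeff 2 * h.coeff 1 - g.coeff 1 * h.coeff 2)
    (hb : b = g.coeff 0 * h.coeff 2 - g.coeff 2 * h.coeff 0)
    (hc : c = g.coeff 1 * h.coeff 0 - g.coeff 0 * h.coeff 1)
    {n : ℕ} (hF : Irreducible F) (hFH : F ∣ quadH a b c (Fintype.card K ^ n))
    (hF1 : 1 < F.natDegree) (hFn : ¬ F.natDegree ∣ n) (hFh : ¬ ∃ u : K, F = C u * h) :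
    ∃ f : K[X], QuadAdmissible g h f ∧ ∃ u : K, u ≠ 0 ∧ F = C u * quadTransform g h f := by
  have hg2 : g.natDegree ≤ 2 := hdeg ▸ le_max_left _ _
  have hh2 : h.natDegree ≤ 2 := hdeg ▸ le_max_right _ _
  have : Fact (Irreducible F) := ⟨hF⟩
  let L := AdjoinRoot F
  let x : L := AdjoinRoot.root F
  have hx : aeval x F = 0 := by simp [x, L, AdjoinRoot.aeval_eq]
  have hFdvd {p : K[X]} (hp : aeval x p = 0) : F ∣ p :=
    (aeval_eq_zero_iff_dvd hF hx).mp hp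
  have hxH := aeval_eq_zero_of_dvd_aeval_eq_zero hFH hx
  have hh0 : h ≠ 0 := by
    intro h0
    have := not_proportional_of_isCoprime hcop (by omega) (s := 0) (t := 1) (by simp [h0])
    exact one_ne_zero this.2
  have hhx : aeval x h ≠ 0 := by
    intro h0
    obtain ⟨u, -, hu⟩ := exists_eq_C_mul_of_dvd (hFdvd h0) hh0 (hh2.trans hF1)
    exact hFh ⟨u, hu⟩
  set β := aeval x g / aeval x h with hβ
  have : Module.Finite K L := (AdjoinRoot.powerBasis hF.ne_zero).finite
  have hβint : IsIntegral K β := IsIntegral.of_finite K β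
  have hβn : β ^ Fintype.card K ^ n = β := by
    have hcross := aeval_cross_eq hg2 hh2 ha hb hc x (x ^ Fintype.card K ^ n)
    rw [← aeval_quadH, hxH, mul_zero, aeval_pow_card_pow, aeval_pow_card_pow, sub_eq_zero] at hcross
    rw [hβ, div_pow, div_eq_div_iff (pow_ne_zero _ hhx) hhx, hcross]
  have hβdeg : (minpoly K β).natDegree ∣ n :=
    (pow_card_pow_eq_self_iff (minpoly.irreducible hβint) (minpoly.aeval K β) n).mp hβn
  have hadm : QuadAdmissible g h (minpoly K β) := by
    refine ⟨minpoly.ne_zero hβint, fun h0 he => ?_⟩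
    -- A root of the minimal polynomial in `K` forces `β` to equal it. Then `R(x) = R(∞)`, which
    -- reduces to `b - ax = 0`; as `x` has degree above one, `a = b = 0`.
    have hβe : β = algebraMap K L (g.coeff 2 / h.coeff 2) := by
      have hroot : aeval (algebraMap K L (g.coeff 2 / h.coeff 2)) (minpoly K β) = 0 := by
        rw [aeval_algebraMap_apply, coe_aeval_eq_eval, he, map_zero]
      exact minpoly.root hβint he ▸ rfl
    have hlin : aeval x (C b - C a * X) = 0 := by
      rw [hβ, map_div₀, div_eq_div_iff hhx (by simpa using h0)] at hβe
      simp only [aeval_eq_quadratic hg2, aeval_eq_quadratic hh2] at hβe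
      simp only [ha, hb, map_sub, map_mul, aeval_C, aeval_X]
      linear_combination hβe
    have hlin0 : C b - C a * X = 0 := by
      by_contra hne
      have hle := natDegree_le_of_dvd (hFdvd hlin) hne
      have : (C b - C a * X).natDegree ≤ 1 := by compute_degree
      omega
    have hb0 := congrArg (coeff · 0) hlin0
    have ha0 := congrArg (coeff · 1) hlin0
    simp [coeff_C] at hb0 ha0
    exact sq_sub_mul_ne_zero_of_isCoprime hcop hdeg ha hb hc (by simp [hb0, ha0])
  have hpx : aeval x (quadTransform g h (minpoly K β)) = 0 := by
    rw [aeval_quadTransform g h _ hhx, ← hβ, minpoly.aeval, mul_zero]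
  have hpdeg := natDegree_quadTransform hdeg hadm
  have hppos : 0 < (minpoly K β).natDegree := minpoly.natDegree_pos hβint
  have hne : quadTransform g h (minpoly K β) ≠ 0 :=
    ne_zero_of_natDegree_gt (n := 0) (by omega)
  have hle := natDegree_le_of_dvd (hFdvd hpx) hne
  have hfin : Module.finrank K L = F.natDegree := finrank_quotient_span_eq_natDegree
  obtain ⟨k, hk⟩ : (minpoly K β).natDegree ∣ F.natDegree := hfin ▸ minpoly.degree_dvd hβint
  -- Excluding `k = 1` gives `deg F ≥ 2 deg β = deg f_R`, so the divisibility of `f_R` by `F` is an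
  -- association.
  have hk1 : k ≠ 1 := by
    rintro rfl
    exact hFn (by rw [hk, mul_one]; exact hβdeg)
  have hk0 : k ≠ 0 := by
    rintro rfl
    omega
  have hge : (minpoly K β).natDegree * 2 ≤ F.natDegree := by
    rw [hk]
    exact Nat.mul_le_mul_left _ (by omega)
  exact ⟨minpoly K β, hadm, exists_eq_C_mul_of_dvd (hFdvd hpx) hne (by omega)⟩

end QuadraticTransformation

theorem theorem4p1 {K : Type*} [Field K] [Fintype K] (g h : K[X])
    (hcop : IsCoprime g h) (hdeg : max g.natDegree h.natDegree = 2)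
    (heven : Even (Fintype.card K) → ¬ (g.coeff 1 = 0 ∧ h.coeff 1 = 0))
    (a b c : K)
    (ha : a = g.coeff 2 * h.coeff 1 - g.coeff 1 * h.coeff 2)
    (hb : b = g.coeff 0 * h.coeff 2 - g.coeff 2 * h.coeff 0)
    (hc : c = g.coeff 1 * h.coeff 0 - g.coeff 0 * h.coeff 1)
    (n : ℕ) (hn : 0 < n) :
    (∀ (f : K[X]) (d : ℕ), QuadAdmissible g h f → Irreducible (quadTransform g h f) →
      Odd d → d * (quadTransform g h f).natDegree = 2 * n →
      quadTransform g h f ∣ quadH a b c (Fintype.card K ^ n)) ∧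
    (∀ F : K[X], Irreducible F → F ∣ quadH a b c (Fintype.card K ^ n) → 1 < F.natDegree →
      (¬ ∃ u : K, F = C u * (C a * X ^ 2 - C (2 * b) * X + C c)) →
      F.natDegree ∣ 2 * n ∧ ¬ F.natDegree ∣ n ∧
      ((¬ ∃ u : K, F = C u * h) →
        ∃ f : K[X], QuadAdmissible g h f ∧
          ∃ u : K, u ≠ 0 ∧ F = C u * quadTransform g h f)) := by
  exact ⟨fun f d hf hirr hd hdn =>
      quadTransform_dvd_quadH hcop hdeg ha hb hc hf hirr hd hdn,
    fun F hF hFH hF1 hFQ =>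
      have h := natDegree_of_dvd_quadH hcop hdeg heven ha hb hc hF hFH hF1 hFQ
      ⟨h.1, h.2, exists_quadTransform_of_dvd_quadH hcop hdeg ha hb hc hF hFH hF1 h.2⟩⟩
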